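/- Let $p_i>0$ $(i\ge 0)$ and $q_i>0$ $(i\ge 1)$, and let $Q=(q_{ij})_{i,j\ge 0}$ be the conservative birth–death $Q$-matrix on $\mathbb{Z}_+=\{0,1,2,\dots\}$: $q_{i,i+1}=p_i$ for $i\ge 0$, $q_{i,i-1}=q_i$ for $i\ge 1$, $q_{00}=-p_0$, $q_{ii}=-(p_i+q_i)$ for $i\ge 1$, and $q_{ij}=0$ otherwise. A (non-explosive) $Q$-process is given by a Markov transition function $(P_t)_{t\ge 0}$ on $\mathbb{Z}_+$ (probability kernels with $P_0=\mathrm{id}$, $P_{s+t}=P_sP_t$) such that $\lim_{t\downarrow 0}(P_t(i,\{j\})-\delta_{ij})/t=q_{ij}$ for all $i,j$. It is called *ergodic* if there is a unique invariant probability measure $\pi$ and $\lim_{t\to\infty}\|P_t(i,\cdot)-\pi\|_{\mathrm{Var}}=0$ for every $i$, where $\|\cdot\|_{\mathrm{Var}}$ denotes total variation distance; it is called *strongly ergodic* if there are $\varepsilon>0$, $C>0$ and an invariant probability measure $\pi$ with $\sup_i\|P_t(i,\cdot)-\pi\|_{\mathrm{Var}}\le C\mathrm{e}^{-\varepsilon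 t}$ for all $t\ge 0$. Then for every $Q$-process the following holds. (1) Let $\alpha\in\mathbb{R}$. If $p_i=q_i=i^{\alpha}$ for all $i\ge 1$ (and $p_0>0$ is arbitrary), then the process is ergodic if and only if $\alpha>1$; furthermore, if $1<\alpha\le 2$, it is not strongly ergodic. (2) If $p_i=p>0$ for all $i\ge 0$ and $q_i=q>p$ for all $i\ge 1$, then the process is ergodic but not strongly ergodic. (3) If $p_i=p>0$ for all $i\ge 0$ and $q_i=i^{\alpha}$ for all $i\ge 1$, with $\alpha\in(0,1]$, then the process is not strongly ergodic. -/

import Mathlib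

open MeasureTheory ProbabilityTheory Filter Topology
open scoped NNReal

noncomputable section

namespace MarkovErgodicity

/-- An (honest) time-homogeneous Markov transition function `P_t(x, ·)`, `t ≥ 0`, on `E`:
Markov kernels with `P_0 = id` and the Chapman-Kolmogorov property. -/
structure IsTransitionFunction {E : Type*} [MeasurableSpace E] (P : ℝ≥0 → Kernel E E) :
    Prop where
  markov : ∀ t, IsMarkovKernel (P t)
  zero : P 0 = Kernel.id
  add : ∀ s t, P (s + t) = P s ∘ₖ P t

/-- `P` is the transition function of a (non-explosive) `Q`-process on the countable discrete
space `E`: a Markov transition function whose right derivative at `t = 0` is the matrix `Q`,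
entry by entry. -/
structure IsQProcess {E : Type*} [Countable E] [MeasurableSpace E] [DiscreteMeasurableSpace E]
    (Q : Matrix E E ℝ) (P : ℝ≥0 → Kernel E E) : Prop extends IsTransitionFunction P where
  deriv_zero : ∀ i j, Tendsto
    (fun t : ℝ≥0 => ((P t i).real {j} - (P 0 i).real {j}) / (t : ℝ)) (𝓝[>] 0) (𝓝 (Q i j))

/-- Total variation distance `sup_A |μ(A) - ν(A)|` (used for probability measures). -/
def tvDist {E : Type*} [MeasurableSpace E] (μ ν : Measure E) : ℝ :=
  ⨆ A : {A : Set E // MeasurableSet A}, |μ.real A - ν.real A|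

/-- `π` is an invariant probability measure: `π(A) = ∫ P_t(x, A) π(dx)` for all `t` and `A`. -/
def IsInvariantProb {E : Type*} [MeasurableSpace E] (P : ℝ≥0 → Kernel E E) (π : Measure E) :
    Prop :=
  IsProbabilityMeasure π ∧ ∀ t, (P t).Invariant π

/-- Ergodicity: there is a unique invariant probability measure `π`, and `P_t(x, ·) → π` in
total variation as `t → ∞` for every `x`. -/
def IsErgodic {E : Type*} [MeasurableSpace E] (P : ℝ≥0 → Kernel E E) : Prop :=
  ∃ π : Measure E, IsInvariantProb P π ∧ (∀ π', IsInvariantProb P π' → π' = π) ∧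
    ∀ x, Tendsto (fun t => tvDist (P t x) π) atTop (𝓝 0)

/-- Strong (uniform) ergodicity: exponential convergence to an invariant probability measure in
total variation, uniformly in the starting point. -/
def IsStronglyErgodic {E : Type*} [MeasurableSpace E] (P : ℝ≥0 → Kernel E E) : Prop :=
  ∃ ε > (0 : ℝ), ∃ C > (0 : ℝ), ∃ π : Measure E, IsInvariantProb P π ∧
    ∀ (t : ℝ≥0) (x : E), tvDist (P t x) π ≤ C * Real.exp (-ε * t)

/-- The conservative birth-death `Q`-matrix on `{0, 1, 2, …}` with birth rates `p i` (`i ≥ 0`)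
and death rates `q i` (`i ≥ 1`; the value `q 0` is not used). -/
def birthDeath (p q : ℕ → ℝ) : Matrix ℕ ℕ ℝ := fun i j =>
  if j = i + 1 then p i
  else if i = j + 1 then q i
  else if i = j then (if i = 0 then -p 0 else -(p i + q i))
  else 0

end MarkovErgodicity

end

set_option linter.unusedSectionVars false

namespace MarkovErgodicity

/-! ### Convergence to equilibrium for positive kernels on a countable space. -/

section Discrete

variable {E : Type*} [Countable E] [MeasurableSpace E] [DiscreteMeasurableSpace E]

/-! Everything rests on the backward equation, on bounded functions, for an arbitrary honest
`Q`-process.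

Ergodicity. Detailed balance makes the partial sums of `μ i * (P_t f i - f i)` telescope to a
boundary flux. With `μ` summable and `μ i * p i` bounded, a nonzero limiting flux would make a
bounded sequence drift to infinity, so the normalised `μ` is invariant (`tsum_mul_integral_eq`). All
entries of `P 1` are positive. Two independent copies therefore form a kernel with positive entries
and an invariant law of full support, for which bounded subharmonic functions are constant. The
limiting discrepancy between two starting points is such a function and vanishes on the diagonal, so
it is zero (`tendsto_discrepancy`). Conversely, if `q i = p i` for `i ≥ 1`, an invariant `π` makes
`π i * p i` nonnegative and concave, hence constant, which forces `1 / p i` to be summable.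

Failure of strong ergodicity. If `h i = 1 / (i + 1)` satisfies `L h ≤ c h` for the generator `L`,
then `P_T h i ≤ exp (c T) * h i`, which tends to `0` as `i → ∞`: far-off states need unbounded time
to come down. Strong ergodicity would bound `P_T h` below uniformly in `i` for some `T`
(`not_isStronglyErgodic_of_rates`). -/

theorem integrable_of_abs_le {μ : Measure E} [IsFiniteMeasure μ] {f : E → ℝ} {B : ℝ}
    (hf : ∀ x, |f x| ≤ B) : Integrable f μ :=
  Integrable.of_bound (Measurable.of_discrete.aestronglyMeasurable) B (ae_of_all _ hf)

theorem abs_integral_le_of_abs_le {μ : Measure E} [IsProbabilityMeasure μ] {f : E → ℝ} {B : ℝ}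
    (hf : ∀ x, |f x| ≤ B) : |∫ x, f x ∂μ| ≤ B := by
  simpa using norm_integral_le_of_norm_le_const (μ := μ) (f := f) (ae_of_all _ hf)

theorem integral_bind_of_abs_le {F : Type*} [MeasurableSpace F] [Countable F]
    [DiscreteMeasurableSpace F] {μ : Measure E} [IsProbabilityMeasure μ]
    {κ : Kernel E F} [IsMarkovKernel κ] {f : F → ℝ} {B : ℝ} (hf : ∀ x, |f x| ≤ B) :
    ∫ y, f y ∂(μ.bind κ) = ∫ x, ∫ y, f y ∂(κ x) ∂μ := by
  rw [Measure.comp_eq_comp_const_apply, Kernel.integral_comp (integrable_of_abs_le hf),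
    Kernel.const_apply]

/-- A bounded subharmonic function of a kernel with positive entries and an invariant probability
of full support is constant. -/
theorem subharmonic_eq_const {κ : Kernel E E} [IsMarkovKernel κ] {ρ : Measure E}
    [IsProbabilityMeasure ρ] (hinv : κ.Invariant ρ) (hρ : ∀ x, 0 < ρ.real {x})
    (hκ : ∀ x y, 0 < (κ x).real {y}) {d : E → ℝ} {B : ℝ} (hd : ∀ x, |d x| ≤ B)
    (hsub : ∀ x, d x ≤ ∫ y, d y ∂(κ x)) (x y : E) : d x = d y := by
  have full : ∀ {μ : Measure E} [IsProbabilityMeasure μ] (_ : ∀ x, 0 < μ.real {x}) {f : E → ℝ}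
      {C : ℝ} (_ : ∀ x, |f x| ≤ C) (_ : ∀ x, 0 ≤ f x) (_ : ∫ x, f x ∂μ = 0) (x : E), f x = 0 := by
    intro μ _ hμ f C hC h0 hint z
    have h := (integral_eq_zero_iff_of_nonneg h0 (integrable_of_abs_le hC)).1 hint
    by_contra hz
    have h1 : μ {z} ≤ 0 := by
      have h2 : μ {w | ¬ f w = (0 : E → ℝ) w} = 0 := h
      rw [← h2]
      exact measure_mono (by simpa using hz)
    have h3 := hμ z
    simp [Measure.real, le_antisymm h1 bot_le] at h3
  -- The defect `κ g - g` is nonnegative and has zero `ρ`-integral by invariance, so it vanishes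
  -- everywhere.
  have harm : ∀ (g : E → ℝ) (C : ℝ), (∀ x, |g x| ≤ C) → (∀ x, g x ≤ ∫ y, g y ∂(κ x)) →
      ∀ x, g x = ∫ y, g y ∂(κ x) := by
    intro g C hC hg z
    have hC' : ∀ x, |∫ y, g y ∂(κ x)| ≤ C := fun x => abs_integral_le_of_abs_le hC
    have hC2 : ∀ x, |(∫ y, g y ∂(κ x)) - g x| ≤ C + C := fun x =>
      (abs_sub _ _).trans (add_le_add (hC' x) (hC x))
    have := full hρ hC2 (fun x => sub_nonneg.2 (hg x)) (by
      rw [integral_sub (integrable_of_abs_le hC') (integrable_of_abs_le hC),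
        ← integral_bind_of_abs_le hC, hinv.def, sub_self]) z
    linarith
  have hd2 : ∀ x, |d x ^ 2| ≤ B ^ 2 := fun x => by
    rw [abs_pow]; exact pow_le_pow_left₀ (abs_nonneg _) (hd x) 2
  have expand : ∀ x, ∫ y, (d y - d x) ^ 2 ∂(κ x) = (∫ y, d y ^ 2 ∂(κ x)) - d x ^ 2 := by
    intro x
    have h1 : ∀ y, (d y - d x) ^ 2 = d y ^ 2 - 2 * d x * d y + d x ^ 2 := fun y => by ring
    have i1 : Integrable (fun y => 2 * d x * d y) (κ x) := (integrable_of_abs_le hd).const_mul _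
    have i2 : Integrable (fun y => d y ^ 2) (κ x) := integrable_of_abs_le hd2
    have i3 : Integrable (fun y => d y ^ 2 - 2 * d x * d y) (κ x) := i2.sub i1
    simp_rw [h1]
    rw [integral_add i3 (integrable_const _), integral_sub i2 i1, integral_const_mul, ← harm d B hd hsub x]
    simp; ring
  -- Nonnegativity of the variance makes `d ^ 2` subharmonic as well, hence harmonic; so `d` has
  -- zero variance under each `κ x`.
  have hvar : ∫ y, (d y - d x) ^ 2 ∂(κ x) = 0 := by
    rw [expand, ← harm (fun y => d y ^ 2) _ hd2 (fun z => ?_) x, sub_self]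
    have := expand z
    have h0 : 0 ≤ ∫ y, (d y - d z) ^ 2 ∂(κ z) := integral_nonneg fun y => sq_nonneg _
    linarith
  have hB : ∀ y, |(d y - d x) ^ 2| ≤ (B + B) ^ 2 := fun y => by
    rw [abs_pow]
    exact pow_le_pow_left₀ (abs_nonneg _) ((abs_sub _ _).trans (add_le_add (hd y) (hd x))) 2
  have := full (hκ x) hB (fun y => sq_nonneg _) hvar y
  have := pow_eq_zero_iff (two_ne_zero) |>.1 this
  linarith

variable {P : ℝ≥0 → Kernel E E}

theorem integral_add_time (hP : IsTransitionFunction P) (s t : ℝ≥0) {f : E → ℝ} {B : ℝ}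
    (hf : ∀ x, |f x| ≤ B) (x : E) :
    ∫ y, f y ∂(P (s + t) x) = ∫ y, ∫ z, f z ∂(P t y) ∂(P s x) := by
  have := hP.markov
  rw [add_comm, hP.add, Kernel.comp_apply]
  exact integral_bind_of_abs_le hf

theorem integral_mem_Icc {μ : Measure E} [IsProbabilityMeasure μ] {f : E → ℝ}
    (hf : ∀ x, f x ∈ Set.Icc (0 : ℝ) 1) : ∫ x, f x ∂μ ∈ Set.Icc (0 : ℝ) 1 := by
  refine ⟨integral_nonneg fun x => (hf x).1, (abs_le.1 (abs_integral_le_of_abs_le fun x => ?_)).2⟩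
  exact abs_le.2 ⟨by linarith [(hf x).1], (hf x).2⟩

/-- The largest discrepancy of `P_t f` between two starting points, over `[0, 1]`-valued `f`. -/
noncomputable def discrepancy (P : ℝ≥0 → Kernel E E) (t : ℝ≥0) (x y : E) : ℝ :=
  ⨆ f : E → Set.Icc (0 : ℝ) 1, |(∫ z, (f z : ℝ) ∂(P t x)) - ∫ z, (f z : ℝ) ∂(P t y)|

theorem abs_sub_le_one_of_mem_Icc {a b : ℝ} (ha : a ∈ Set.Icc (0 : ℝ) 1)
    (hb : b ∈ Set.Icc (0 : ℝ) 1) : |a - b| ≤ 1 :=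
  abs_le.2 ⟨by linarith [ha.1, hb.2], by linarith [ha.2, hb.1]⟩

theorem abs_sub_le_discrepancy (hP : IsTransitionFunction P) (t : ℝ≥0) (x y : E) {f : E → ℝ}
    (hf : ∀ x, f x ∈ Set.Icc (0 : ℝ) 1) :
    |(∫ z, f z ∂(P t x)) - ∫ z, f z ∂(P t y)| ≤ discrepancy P t x y := by
  have := hP.markov
  refine le_ciSup (f := fun f : E → Set.Icc (0 : ℝ) 1 =>
    |(∫ z, (f z : ℝ) ∂(P t x)) - ∫ z, (f z : ℝ) ∂(P t y)|) ⟨1, ?_⟩ (fun z => ⟨f z, hf z⟩)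
  rintro _ ⟨g, rfl⟩
  exact abs_sub_le_one_of_mem_Icc (integral_mem_Icc fun x => (g x).2)
    (integral_mem_Icc fun x => (g x).2)

theorem discrepancy_le {t : ℝ≥0} {x y : E} {c : ℝ}
    (h : ∀ f : E → ℝ, (∀ x, f x ∈ Set.Icc (0 : ℝ) 1) →
      |(∫ z, f z ∂(P t x)) - ∫ z, f z ∂(P t y)| ≤ c) : discrepancy P t x y ≤ c :=
  ciSup_le fun f => h _ fun x => (f x).2

theorem discrepancy_nonneg (t : ℝ≥0) (x y : E) : 0 ≤ discrepancy P t x y :=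
  Real.iSup_nonneg fun _ => abs_nonneg _

theorem discrepancy_le_one (hP : IsTransitionFunction P) (t : ℝ≥0) (x y : E) :
    discrepancy P t x y ≤ 1 := by
  have := hP.markov
  exact discrepancy_le fun f hf => abs_sub_le_one_of_mem_Icc (integral_mem_Icc hf)
    (integral_mem_Icc hf)

theorem discrepancy_self (t : ℝ≥0) (x : E) : discrepancy P t x x = 0 :=
  le_antisymm (discrepancy_le fun f _ => by simp) (discrepancy_nonneg _ _ _)

theorem abs_discrepancy_le_one (hP : IsTransitionFunction P) (t : ℝ≥0) (x y : E) :
    |discrepancy P t x y| ≤ 1 := by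
  rw [abs_of_nonneg (discrepancy_nonneg _ _ _)]
  exact discrepancy_le_one hP _ _ _

theorem abs_le_one_of_mem_Icc {f : E → ℝ} (hf : ∀ x, f x ∈ Set.Icc (0 : ℝ) 1) (x : E) :
    |f x| ≤ 1 := abs_le.2 ⟨by linarith [(hf x).1], (hf x).2⟩

theorem discrepancy_antitone (hP : IsTransitionFunction P) (x y : E) :
    Antitone fun t => discrepancy P t x y := by
  have := hP.markov
  intro s t hst
  obtain ⟨r, rfl⟩ := exists_add_of_le hst
  refine discrepancy_le fun f hf => ?_
  rw [integral_add_time hP s r (abs_le_one_of_mem_Icc hf),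
    integral_add_time hP s r (abs_le_one_of_mem_Icc hf)]
  exact abs_sub_le_discrepancy hP s x y fun x => integral_mem_Icc hf

/-- Run the two copies independently up to time `s`, then compare the remaining evolutions over time
`t`. -/
theorem discrepancy_add_le (hP : IsTransitionFunction P) (s t : ℝ≥0) (x y : E) :
    discrepancy P (s + t) x y ≤
      ∫ z, discrepancy P t z.1 z.2 ∂((P s x).prod (P s y)) := by
  have := hP.markov
  refine discrepancy_le fun f hf => ?_
  rw [integral_add_time hP s t (abs_le_one_of_mem_Icc hf),
    integral_add_time hP s t (abs_le_one_of_mem_Icc hf)]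
  have hg : ∀ x, ∫ z, f z ∂(P t x) ∈ Set.Icc (0 : ℝ) 1 := fun x => integral_mem_Icc hf
  set g : E → ℝ := fun x => ∫ z, f z ∂(P t x) with hgdef
  have e1 : ∫ z, g z ∂(P s x) = ∫ z, g z.1 ∂((P s x).prod (P s y)) := by
    simp [integral_fun_fst]
  have e2 : ∫ z, g z ∂(P s y) = ∫ z, g z.2 ∂((P s x).prod (P s y)) := by
    simp [integral_fun_snd]
  have i1 : Integrable (fun z : E × E => g z.1) ((P s x).prod (P s y)) :=
    integrable_of_abs_le fun z => abs_le_one_of_mem_Icc hg z.1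
  have i2 : Integrable (fun z : E × E => g z.2) ((P s x).prod (P s y)) :=
    integrable_of_abs_le fun z => abs_le_one_of_mem_Icc hg z.2
  rw [e1, e2, ← integral_sub i1 i2]
  refine (abs_integral_le_integral_abs).trans (integral_mono_of_nonneg
    (ae_of_all _ fun _ => abs_nonneg _) (integrable_of_abs_le fun z =>
      abs_discrepancy_le_one hP t z.1 z.2) (ae_of_all _ fun z => ?_))
  exact abs_sub_le_discrepancy hP t z.1 z.2 hf

theorem invariant_parallelComp {κ : Kernel E E} [IsMarkovKernel κ] {ρ : Measure E}
    [IsProbabilityMeasure ρ] (h : κ.Invariant ρ) : (κ ∥ₖ κ).Invariant (ρ.prod ρ) := by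
  have h' : ∀ s : Set E, ∫⁻ x, κ x s ∂ρ = ρ s := fun s => by
    rw [← Measure.bind_apply .of_discrete (Kernel.aemeasurable _), h.def]
  refine (Measure.prod_eq fun s t hs ht => ?_).symm
  rw [Measure.bind_apply .of_discrete (Kernel.aemeasurable _)]
  simp_rw [Kernel.parallelComp_apply_prod]
  rw [lintegral_prod_mul (f := fun x => κ x s) (g := fun x => κ x t) (Measurable.of_discrete).aemeasurable
    (Measurable.of_discrete).aemeasurable, h', h']

theorem tendsto_discrepancy (hP : IsTransitionFunction P) {ρ : Measure E}
    [IsProbabilityMeasure ρ] (hinv : (P 1).Invariant ρ) (hρ : ∀ x, 0 < ρ.real {x})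
    (hpos : ∀ x y, 0 < (P 1 x).real {y}) (x y : E) :
    Tendsto (fun t => discrepancy P t x y) atTop (𝓝 0) := by
  have := hP.markov
  have hbdd : ∀ x y, BddBelow (Set.range fun t => discrepancy P t x y) := fun x y =>
    ⟨0, by rintro _ ⟨t, rfl⟩; exact discrepancy_nonneg _ _ _⟩
  have hlim : ∀ x y, Tendsto (fun t => discrepancy P t x y) atTop
      (𝓝 (⨅ t, discrepancy P t x y)) := fun x y =>
    tendsto_atTop_ciInf (discrepancy_antitone hP x y) (hbdd x y)
  have h0 : ∀ x y, 0 ≤ ⨅ t, discrepancy P t x y := fun x y =>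
    le_ciInf fun t => discrepancy_nonneg _ _ _
  have h1 : ∀ z : E × E, |⨅ t, discrepancy P t z.1 z.2| ≤ 1 := fun z => by
    rw [abs_of_nonneg (h0 _ _)]
    exact (ciInf_le (hbdd _ _) 0).trans (discrepancy_le_one hP _ _ _)
  have hsub : ∀ z : E × E, ⨅ t, discrepancy P t z.1 z.2 ≤
      ∫ w, ⨅ t, discrepancy P t w.1 w.2 ∂((P 1 ∥ₖ P 1) z) := by
    intro z
    rw [Kernel.parallelComp_apply]
    have : Tendsto (fun t => ∫ w, discrepancy P t w.1 w.2 ∂((P 1 z.1).prod (P 1 z.2))) atTop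
        (𝓝 (∫ w, ⨅ t, discrepancy P t w.1 w.2 ∂((P 1 z.1).prod (P 1 z.2)))) :=
      tendsto_integral_filter_of_dominated_convergence (fun _ => 1)
        (Eventually.of_forall fun t => Measurable.of_discrete.aestronglyMeasurable)
        (Eventually.of_forall fun t => ae_of_all _ fun w => abs_discrepancy_le_one hP t w.1 w.2)
        (integrable_const _) (ae_of_all _ fun w => hlim w.1 w.2)
    exact ge_of_tendsto' this fun t => (ciInf_le (hbdd _ _) (1 + t)).trans
      (discrepancy_add_le hP 1 t _ _)
  have hreal : ∀ (μ ν : Measure E) [IsProbabilityMeasure μ] [IsProbabilityMeasure ν],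
      (∀ x, 0 < μ.real {x}) → (∀ x, 0 < ν.real {x}) → ∀ z, 0 < (μ.prod ν).real {z} := by
    intro μ ν _ _ hμ hν z
    rw [← Set.singleton_prod_singleton, measureReal_prod_prod]
    exact mul_pos (hμ _) (hν _)
  have hconst := subharmonic_eq_const (invariant_parallelComp hinv) (hreal ρ ρ hρ hρ)
    (fun z w => by
      rw [Kernel.parallelComp_apply]; exact hreal _ _ (hpos _) (hpos _) w) h1 hsub (x, y) (x, x)
  have := hlim x y
  simp only [discrepancy_self, ciInf_const] at hconst
  rwa [hconst] at this

theorem tvDist_nonneg (μ ν : Measure E) : 0 ≤ tvDist μ ν :=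
  Real.iSup_nonneg fun _ => abs_nonneg _

theorem tvDist_le {μ ν : Measure E} {c : ℝ} (h : ∀ A : Set E, |μ.real A - ν.real A| ≤ c) :
    tvDist μ ν ≤ c :=
  haveI : Nonempty {A : Set E // MeasurableSet A} := ⟨⟨∅, .empty⟩⟩
  ciSup_le fun A => h A

theorem abs_sub_le_tvDist {μ ν : Measure E} [IsProbabilityMeasure μ] [IsProbabilityMeasure ν]
    (A : Set E) : |μ.real A - ν.real A| ≤ tvDist μ ν := by
  refine le_ciSup (f := fun A : {A : Set E // MeasurableSet A} => |μ.real A - ν.real A|)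
    ⟨1, ?_⟩ ⟨A, .of_discrete⟩
  rintro _ ⟨g, rfl⟩
  exact abs_sub_le_one_of_mem_Icc ⟨measureReal_nonneg, measureReal_le_one⟩
    ⟨measureReal_nonneg, measureReal_le_one⟩

theorem real_eq_integral_of_invariant {κ : Kernel E E} [IsMarkovKernel κ] {ρ : Measure E}
    [IsProbabilityMeasure ρ] (h : κ.Invariant ρ) (A : Set E) :
    ρ.real A = ∫ x, (κ x).real A ∂ρ := by
  have := integral_bind_of_abs_le (μ := ρ) (κ := κ) (f := A.indicator 1) (B := 1) (fun x => by
    by_cases hx : x ∈ A <;> simp [hx])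
  rw [h.def] at this
  simpa [integral_indicator_one (MeasurableSet.of_discrete (s := A))] using this

/-- By invariance, `tvDist (P t x) ρ` is at most the `ρ`-average over `y` of the discrepancy between
`x` and `y`, so dominated convergence applies. Integrating the convergence against another invariant
law gives uniqueness. -/
theorem isErgodic_of_pos (hP : IsTransitionFunction P) {ρ : Measure E}
    (hinv : IsInvariantProb P ρ) (hρ : ∀ x, 0 < ρ.real {x})
    (hpos : ∀ x y, 0 < (P 1 x).real {y}) : IsErgodic P := by
  have := hP.markov
  have := hinv.1
  have hlim := tendsto_discrepancy hP (hinv.2 1) hρ hpos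
  have hbd : ∀ (t : ℝ≥0) (A : Set E) x, |(P t x).real A| ≤ 1 := fun t A x => by
    rw [abs_of_nonneg measureReal_nonneg]; exact measureReal_le_one
  have key : ∀ t x, tvDist (P t x) ρ ≤ ∫ y, discrepancy P t x y ∂ρ := by
    refine fun t x => tvDist_le fun A => ?_
    rw [real_eq_integral_of_invariant (hinv.2 t) A]
    have : (P t x).real A - ∫ y, (P t y).real A ∂ρ
        = ∫ y, ((P t x).real A - (P t y).real A) ∂ρ := by
      rw [integral_sub (integrable_const _) (integrable_of_abs_le (hbd t A))]; simp
    rw [this]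
    refine (abs_integral_le_integral_abs).trans (integral_mono_of_nonneg
      (ae_of_all _ fun _ => abs_nonneg _) (integrable_of_abs_le fun z =>
      abs_discrepancy_le_one hP t x z) (ae_of_all _ fun y => ?_))
    have := abs_sub_le_discrepancy hP t x y (f := A.indicator 1) (fun z => by
      by_cases hz : z ∈ A <;> simp [hz])
    simpa [integral_indicator_one (MeasurableSet.of_discrete (s := A))] using this
  have htv : ∀ x, Tendsto (fun t => tvDist (P t x) ρ) atTop (𝓝 0) := by
    intro x
    have : Tendsto (fun t => ∫ y, discrepancy P t x y ∂ρ) atTop (𝓝 (∫ _, (0 : ℝ) ∂ρ)) :=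
      tendsto_integral_filter_of_dominated_convergence (fun _ => 1)
        (Eventually.of_forall fun t => Measurable.of_discrete.aestronglyMeasurable)
        (Eventually.of_forall fun t => ae_of_all _ fun w => abs_discrepancy_le_one hP t x w)
        (integrable_const _) (ae_of_all _ fun w => hlim x w)
    rw [integral_zero] at this
    exact squeeze_zero (fun t => tvDist_nonneg _ _) (fun t => key t x) this
  refine ⟨ρ, hinv, fun π' h' => ?_, htv⟩
  have := h'.1
  refine Measure.ext_of_measureReal_singleton fun a => ?_
  generalize ({a} : Set E) = A
  have : Tendsto (fun t => ∫ x, (P t x).real A ∂π') atTop (𝓝 (∫ _, ρ.real A ∂π')) :=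
    tendsto_integral_filter_of_dominated_convergence (fun _ => 1)
      (Eventually.of_forall fun t => Measurable.of_discrete.aestronglyMeasurable)
      (Eventually.of_forall fun t => ae_of_all _ fun w => hbd t A w)
      (integrable_const _) (ae_of_all _ fun w => by
        rw [tendsto_iff_norm_sub_tendsto_zero]
        exact squeeze_zero (fun t => norm_nonneg _) (fun t => abs_sub_le_tvDist A) (htv w))
  simp_rw [← fun t => real_eq_integral_of_invariant (h'.2 t) A] at this
  simpa using tendsto_nhds_unique tendsto_const_nhds this

end Discrete

/-! ### Differentiability at zero and continuity in time. -/

section Discrete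

variable {E : Type*} [Countable E] [MeasurableSpace E] [DiscreteMeasurableSpace E]
  {Q : Matrix E E ℝ} {P : ℝ≥0 → Kernel E E}

theorem IsTransitionFunction.real_zero_self (hP : IsTransitionFunction P) (i : E) :
    (P 0 i).real {i} = 1 := by
  rw [hP.zero, Kernel.id_apply]; simp [Measure.real]

theorem IsTransitionFunction.integral_zero (hP : IsTransitionFunction P) (f : E → ℝ) (i : E) :
    ∫ y, f y ∂(P 0 i) = f i := by
  rw [hP.zero, Kernel.id_apply, integral_dirac]

theorem abs_integral_sub_sum_le {μ : Measure E} [IsProbabilityMeasure μ] {f : E → ℝ} {B : ℝ}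
    (hf : ∀ x, |f x| ≤ B) (N : Finset E) :
    |(∫ x, f x ∂μ) - ∑ j ∈ N, μ.real {j} * f j| ≤ B * (1 - ∑ j ∈ N, μ.real {j}) := by
  have hi : Integrable f μ := integrable_of_abs_le hf
  have h1 : ∫ x in (N : Set E), f x ∂μ = ∑ j ∈ N, μ.real {j} * f j := by
    simpa using setIntegral_finset N hi.integrableOn
  rw [← h1, ← integral_add_compl (MeasurableSet.of_discrete (s := (N : Set E))) hi,
    add_sub_cancel_left, sum_measureReal_singleton, ← probReal_compl_eq_one_sub .of_discrete]
  exact norm_setIntegral_le_of_norm_le_const (f := f) (measure_lt_top _ _) fun x _ => hf x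

/-- The row of `Q` sums to zero over the finite set `N`, so the mass leaving `N` by time `t` is
`o(t)`; entrywise derivatives then suffice for every bounded `f`. -/
theorem IsQProcess.tendsto_integral_sub_div (hP : IsQProcess Q P) {i : E} {N : Finset E}
    (hi : i ∈ N) (hN : ∑ j ∈ N, Q i j = 0) {f : E → ℝ} {B : ℝ} (hf : ∀ x, |f x| ≤ B) :
    Tendsto (fun t : ℝ≥0 => ((∫ y, f y ∂(P t i)) - f i) / t) (𝓝[>] 0)
      (𝓝 (∑ j ∈ N, Q i j * f j)) := by
  have := hP.markov
  classical
  have h0 : ∀ j, (P 0 i).real {j} = if i = j then 1 else 0 := fun j => by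
    rw [hP.zero, Kernel.id_apply]
    by_cases h : i = j <;> simp [Measure.real, h]
  have hsum : ∀ g : E → ℝ, ∑ j ∈ N, (P 0 i).real {j} * g j = g i := fun g => by
    simp [h0, hi]
  have hmain : Tendsto (fun t : ℝ≥0 => ∑ j ∈ N,
      ((P t i).real {j} - (P 0 i).real {j}) / (t : ℝ) * f j) (𝓝[>] 0)
      (𝓝 (∑ j ∈ N, Q i j * f j)) :=
    tendsto_finsetSum _ fun j _ => (hP.deriv_zero i j).mul_const _
  have herr : Tendsto (fun t : ℝ≥0 => -B * ∑ j ∈ N,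
      ((P t i).real {j} - (P 0 i).real {j}) / (t : ℝ)) (𝓝[>] 0) (𝓝 0) := by
    have : Tendsto (fun t : ℝ≥0 => ∑ j ∈ N,
        ((P t i).real {j} - (P 0 i).real {j}) / (t : ℝ)) (𝓝[>] 0) (𝓝 (∑ j ∈ N, Q i j)) :=
      tendsto_finsetSum _ fun j _ => hP.deriv_zero i j
    rw [hN] at this
    simpa using this.const_mul (-B)
  have hsq := squeeze_zero_norm (f := fun t : ℝ≥0 => ((∫ y, f y ∂(P t i)) - f i) / (t : ℝ) -
      ∑ j ∈ N, ((P t i).real {j} - (P 0 i).real {j}) / (t : ℝ) * f j) (fun t => ?_) herr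
  · simpa using hsq.add hmain
  · have h1 : ∑ j ∈ N, ((P t i).real {j} - (P 0 i).real {j}) / (t : ℝ) * f j =
        ((∑ j ∈ N, (P t i).real {j} * f j) - f i) / t := by
      rw [← hsum f, ← Finset.sum_sub_distrib, Finset.sum_div]
      exact Finset.sum_congr rfl fun j _ => by ring
    have h2 : ∑ j ∈ N, ((P t i).real {j} - (P 0 i).real {j}) / (t : ℝ) =
        ((∑ j ∈ N, (P t i).real {j}) - 1) / t := by
      rw [← hsum (fun _ => 1), ← Finset.sum_div, Finset.sum_sub_distrib]
      simp
    rw [h1, h2, ← sub_div, Real.norm_eq_abs, abs_div, abs_of_nonneg t.coe_nonneg, mul_div_assoc']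
    refine div_le_div_of_nonneg_right ?_ t.coe_nonneg
    have := abs_integral_sub_sum_le (μ := P t i) hf N
    rw [sub_sub_sub_cancel_right]
    linarith

theorem IsQProcess.tendsto_real_self (hP : IsQProcess Q P) (i : E) :
    Tendsto (fun t : ℝ≥0 => (P t i).real {i}) (𝓝 0) (𝓝 1) := by
  have h1 := hP.deriv_zero i i
  have h2 : Tendsto (fun t : ℝ≥0 => (t : ℝ)) (𝓝[>] 0) (𝓝 0) :=
    (NNReal.tendsto_coe.2 tendsto_id).mono_left nhdsWithin_le_nhds
  have h3 := (h1.mul h2).add_const ((P 0 i).real {i})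
  rw [mul_zero, zero_add] at h3
  have h4 : ContinuousWithinAt (fun t : ℝ≥0 => (P t i).real {i}) (Set.Ioi 0) 0 := by
    refine h3.congr' ?_
    filter_upwards [self_mem_nhdsWithin] with t ht
    have : (t : ℝ) ≠ 0 := by exact_mod_cast (ne_of_gt ht)
    field_simp
    ring
  have h5 := continuousWithinAt_Ioi_iff_Ici.1 h4
  have h6 : Set.Ici (0 : ℝ≥0) = Set.univ := by ext; simp
  rw [h6, continuousWithinAt_univ, ContinuousAt, hP.real_zero_self] at h5
  exact h5

/-- Condition on the position after the time difference `h`: on the event of being at `i` the two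
expectations agree. -/
theorem IsTransitionFunction.abs_integral_sub_le (hP : IsTransitionFunction P) {f : E → ℝ} {B : ℝ}
    (hf : ∀ x, |f x| ≤ B) (i : E) (s t : ℝ≥0) :
    |(∫ y, f y ∂(P t i)) - ∫ y, f y ∂(P s i)| ≤ 2 * B * (1 - (P (nndist t s) i).real {i}) := by
  have := hP.markov
  wlog hst : s ≤ t generalizing s t
  · rw [abs_sub_comm, nndist_comm]; exact this t s (le_of_not_ge hst)
  obtain ⟨h, rfl⟩ := exists_add_of_le hst
  have hd : nndist (s + h) s = h := by
    apply NNReal.coe_injective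
    rw [coe_nndist, NNReal.dist_eq]; simp
  rw [hd, add_comm, integral_add_time hP h s hf]
  have hg : ∀ x, |∫ z, f z ∂(P s x)| ≤ B := fun x => abs_integral_le_of_abs_le hf
  have h1 := abs_integral_sub_sum_le (μ := P h i) hg {i}
  simp only [Finset.sum_singleton] at h1
  have h2 : |(1 - (P h i).real {i}) * ∫ z, f z ∂(P s i)| ≤ (1 - (P h i).real {i}) * B := by
    have h3 : 0 ≤ 1 - (P h i).real {i} := sub_nonneg.2 measureReal_le_one
    rw [abs_mul, abs_of_nonneg h3]
    exact mul_le_mul_of_nonneg_left (hg i) h3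
  rw [abs_le] at *
  constructor <;> nlinarith

theorem IsQProcess.continuous_integral (hP : IsQProcess Q P) {f : E → ℝ} {B : ℝ}
    (hf : ∀ x, |f x| ≤ B) (i : E) : Continuous fun t : ℝ≥0 => ∫ y, f y ∂(P t i) := by
  rw [continuous_iff_continuousAt]
  intro s
  rw [ContinuousAt, tendsto_iff_norm_sub_tendsto_zero]
  refine squeeze_zero (fun t => norm_nonneg _)
    (fun t => hP.toIsTransitionFunction.abs_integral_sub_le hf i s t) ?_
  have h1 : Tendsto (fun t : ℝ≥0 => nndist t s) (𝓝 s) (𝓝 0) := by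
    have : Continuous fun t : ℝ≥0 => nndist t s := by fun_prop
    simpa using this.tendsto s
  have h2 := (((hP.tendsto_real_self i).comp h1).const_sub 1).const_mul (2 * B)
  simpa using h2

end Discrete

/-! ### The backward equation. -/

section BirthDeath

variable {p q : ℕ → ℝ} {P : ℝ≥0 → Kernel ℕ ℕ}

/-- The birth-death generator; the value `q 0` plays no role because `0 - 1 = 0`. -/
def generator (p q : ℕ → ℝ) (f : ℕ → ℝ) (i : ℕ) : ℝ :=
  p i * (f (i + 1) - f i) + q i * (f (i - 1) - f i)

/-- The time evolution `t ↦ P_t f (i)` as a function of real time. -/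
noncomputable def evolution (P : ℝ≥0 → Kernel ℕ ℕ) (f : ℕ → ℝ) (t : ℝ) (i : ℕ) : ℝ :=
  ∫ y, f y ∂(P t.toNNReal i)

theorem tendsto_generator (hP : IsQProcess (birthDeath p q) P) {f : ℕ → ℝ} {B : ℝ}
    (hf : ∀ x, |f x| ≤ B) (i : ℕ) :
    Tendsto (fun t : ℝ≥0 => ((∫ y, f y ∂(P t i)) - f i) / t) (𝓝[>] 0)
      (𝓝 (generator p q f i)) := by
  rcases i with _ | i
  · convert hP.tendsto_integral_sub_div (i := 0) (N := {0, 1}) (by simp) ?_ hf using 2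
    · simp [birthDeath, generator]; ring
    · simp [birthDeath]
  · have h0 : i ≠ i + 1 + 1 := by omega
    have h1 : i ∉ ({i + 1, i + 2} : Finset ℕ) := by simp
    have h2 : i + 1 ∉ ({i + 2} : Finset ℕ) := by simp
    convert hP.tendsto_integral_sub_div (i := i + 1) (N := {i, i + 1, i + 2}) (by simp) ?_ hf using 2
    · rw [Finset.sum_insert h1, Finset.sum_insert h2]
      simp [birthDeath, generator, h0]; ring
    · rw [Finset.sum_insert h1, Finset.sum_insert h2]
      simp [birthDeath, h0]

theorem abs_evolution_le (hP : IsQProcess (birthDeath p q) P) {f : ℕ → ℝ} {B : ℝ}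
    (hf : ∀ x, |f x| ≤ B) (t : ℝ) (i : ℕ) : |evolution P f t i| ≤ B :=
  haveI := hP.markov
  abs_integral_le_of_abs_le hf

theorem evolution_zero (hP : IsQProcess (birthDeath p q) P) (f : ℕ → ℝ) (i : ℕ) :
    evolution P f 0 i = f i := by
  simp [evolution, hP.toIsTransitionFunction.integral_zero]

theorem continuous_evolution (hP : IsQProcess (birthDeath p q) P) {f : ℕ → ℝ} {B : ℝ}
    (hf : ∀ x, |f x| ≤ B) (i : ℕ) : Continuous fun t => evolution P f t i :=
  (hP.continuous_integral hf i).comp continuous_real_toNNReal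

theorem continuous_generator_evolution (hP : IsQProcess (birthDeath p q) P) {f : ℕ → ℝ} {B : ℝ}
    (hf : ∀ x, |f x| ≤ B) (i : ℕ) :
    Continuous fun t => generator p q (evolution P f t) i := by
  have h := fun i => continuous_evolution hP hf i
  exact (((h (i + 1)).sub (h i)).const_mul _).add (((h (i - 1)).sub (h i)).const_mul _)

theorem hasDerivWithinAt_evolution (hP : IsQProcess (birthDeath p q) P) {f : ℕ → ℝ} {B : ℝ}
    (hf : ∀ x, |f x| ≤ B) (i : ℕ) {t : ℝ} (ht : 0 ≤ t) :
    HasDerivWithinAt (fun t => evolution P f t i) (generator p q (evolution P f t) i)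
      (Set.Ioi t) t := by
  rw [hasDerivWithinAt_iff_tendsto_slope' (by simp)]
  have h1 : Tendsto (fun s : ℝ => (s - t).toNNReal) (𝓝[>] t) (𝓝[>] 0) := by
    refine tendsto_nhdsWithin_iff.2 ⟨?_, ?_⟩
    · have : Continuous fun s : ℝ => (s - t).toNNReal := by fun_prop
      simpa using (this.tendsto t).mono_left nhdsWithin_le_nhds
    · filter_upwards [self_mem_nhdsWithin] with s hs
      exact Real.toNNReal_pos.2 (sub_pos.2 hs)
  refine ((tendsto_generator hP (fun x => abs_evolution_le hP hf t x) i).comp h1).congr' ?_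
  filter_upwards [self_mem_nhdsWithin] with s hs
  have hs' : 0 ≤ s - t := (sub_pos.2 hs).le
  have h2 : s.toNNReal = (s - t).toNNReal + t.toNNReal := by
    rw [← Real.toNNReal_add hs' ht, sub_add_cancel]
  simp only [Function.comp_apply, slope, vsub_eq_sub, smul_eq_mul, evolution, h2]
  rw [integral_add_time hP.toIsTransitionFunction _ _ hf, Real.coe_toNNReal _ hs']
  ring

theorem integral_generator_evolution (hP : IsQProcess (birthDeath p q) P) {f : ℕ → ℝ} {B : ℝ}
    (hf : ∀ x, |f x| ≤ B) (i : ℕ) {t : ℝ} (ht : 0 ≤ t) :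
    ∫ s in (0 : ℝ)..t, generator p q (evolution P f s) i = evolution P f t i - f i := by
  rw [← evolution_zero hP f i]
  exact intervalIntegral.integral_eq_sub_of_hasDeriv_right_of_le ht
    (continuous_evolution hP hf i).continuousOn
    (fun s hs => hasDerivWithinAt_evolution hP hf i hs.1.le)
    ((continuous_generator_evolution hP hf i).intervalIntegrable _ _)

/-- The right derivative is continuous in time, so the evolution is the integral of it and is
differentiable on both sides. -/
theorem hasDerivAt_evolution (hP : IsQProcess (birthDeath p q) P) {f : ℕ → ℝ} {B : ℝ}
    (hf : ∀ x, |f x| ≤ B) (i : ℕ) {t : ℝ} (ht : 0 < t) :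
    HasDerivAt (fun t => evolution P f t i) (generator p q (evolution P f t) i) t := by
  have hc := continuous_generator_evolution hP hf i
  have h := (intervalIntegral.integral_hasDerivAt_right (hc.intervalIntegrable 0 t)
    (hc.stronglyMeasurableAtFilter _ _) hc.continuousAt).add_const (f i)
  refine h.congr_of_eventuallyEq ?_
  filter_upwards [lt_mem_nhds ht] with s hs
  rw [integral_generator_evolution hP hf i hs.le, sub_add_cancel]

end BirthDeath

/-! ### Comparison principle and failure of strong ergodicity. -/

section BirthDeath

variable {p q : ℕ → ℝ} {P : ℝ≥0 → Kernel ℕ ℕ}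

theorem generator_nonpos_of_max (hp : ∀ i, 0 ≤ p i) (hq : ∀ i, 1 ≤ i → 0 ≤ q i) {f : ℕ → ℝ}
    {i : ℕ} (h : ∀ j, f j ≤ f i) : generator p q f i ≤ 0 := by
  rcases i with _ | i
  · have := mul_nonneg (hp 0) (sub_nonneg.2 (h 1))
    simp only [generator, zero_add, zero_tsub, sub_self, mul_zero, add_zero]
    linarith
  · have h1 := mul_nonneg (hp (i + 1)) (sub_nonneg.2 (h (i + 1 + 1)))
    have h2 := mul_nonneg (hq (i + 1) (by omega)) (sub_nonneg.2 (h (i + 1 - 1)))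
    simp only [generator]
    linarith

theorem nonneg_of_hasDerivAt_of_left_max {z : ℝ → ℝ} {z' t : ℝ} (ht : 0 < t)
    (hz : HasDerivAt z z' t) (hmax : ∀ s ∈ Set.Icc 0 t, z s ≤ z t) : 0 ≤ z' := by
  have h := (hasDerivWithinAt_iff_tendsto_slope' (s := Set.Iio t) (by simp)).1
    hz.hasDerivWithinAt
  refine ge_of_tendsto h ?_
  filter_upwards [Ioo_mem_nhdsLT ht] with s hs
  rw [slope_def_field]
  exact div_nonneg_of_nonpos (by linarith [hmax s ⟨hs.1.le, hs.2.le⟩]) (by linarith [hs.2])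

/-- Comparison principle for the backward equation with a Lyapunov function `g`. -/
theorem evolution_le_of_generator_le (hP : IsQProcess (birthDeath p q) P)
    (hp : ∀ i, 0 ≤ p i) (hq : ∀ i, 1 ≤ i → 0 ≤ q i) {c : ℝ} (hc : 0 < c)
    {g : ℕ → ℝ} (hg0 : ∀ i, 0 < g i) (hg : Tendsto g atTop atTop)
    (hgc : ∀ i, generator p q g i ≤ c * g i) {h : ℕ → ℝ} {B : ℝ} (hB : ∀ i, |h i| ≤ B)
    (hhc : ∀ i, generator p q h i ≤ c * h i) {t : ℝ} (ht : 0 ≤ t) (i : ℕ) :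
    Real.exp (-c * t) * evolution P h t i ≤ h i := by
  have main : ∀ ε > 0, Real.exp (-c * t) * evolution P h t i ≤ h i + ε * g i := by
    intro ε hε
    by_contra! hcon
    -- The penalty `ε * g` makes `z ≤ 0` far out, so a positive value of `z` forces a positive
    -- global maximum on `[0, t] × ℕ`.
    set z : ℝ × ℕ → ℝ := fun w =>
      Real.exp (-c * w.1) * evolution P h w.1 w.2 - h w.2 - ε * g w.2 with hzdef
    have hzc : Continuous z := continuous_prod_of_discrete_right.2 fun j => by
      have := continuous_evolution hP hB j
      simp only [hzdef]
      fun_prop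
    obtain ⟨n, hn⟩ := (hg.eventually_ge_atTop (2 * B / ε)).exists_forall_of_atTop
    have hfar : ∀ s j, 0 ≤ s → n ≤ j → z (s, j) ≤ 0 := by
      intro s j hs hj
      have h1 := hn j hj
      rw [div_le_iff₀ hε] at h1
      have h2 : Real.exp (-c * s) ≤ 1 := Real.exp_le_one_iff.2 (by nlinarith)
      have h3 := (abs_le.1 (abs_evolution_le hP hB s j)).2
      have h4 := (abs_le.1 (hB j)).1
      have h5 : 0 ≤ B := (abs_nonneg _).trans (hB 0)
      have h6 : Real.exp (-c * s) * evolution P h s j ≤ Real.exp (-c * s) * B :=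
        mul_le_mul_of_nonneg_left h3 (Real.exp_pos _).le
      simp only [hzdef]
      nlinarith
    have hz0 : 0 < z (t, i) := by simp only [hzdef]; linarith
    have hi : i < n := by
      by_contra! hi
      exact absurd (hfar t i ht hi) (not_le.2 hz0)
    obtain ⟨⟨s, j⟩, ⟨hs, hj⟩, hmax⟩ := ((isCompact_Icc (a := (0 : ℝ)) (b := t)).prod
      (Set.finite_Iio n).isCompact).exists_isMaxOn ⟨(t, i), ⟨ht, le_rfl⟩, hi⟩ hzc.continuousOn
    have hmax' : ∀ r ∈ Set.Icc 0 t, ∀ k < n, z (r, k) ≤ z (s, j) := fun r hr k hk =>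
      hmax (show (r, k) ∈ Set.Icc 0 t ×ˢ Set.Iio n from ⟨hr, hk⟩)
    have hzpos : 0 < z (s, j) := hz0.trans_le (hmax' t ⟨ht, le_rfl⟩ i hi)
    have hspos : 0 < s := by
      refine lt_of_le_of_ne hs.1 fun h0 => ?_
      have : 0 < z (s, j) := hzpos
      simp only [hzdef] at this
      rw [← show (0 : ℝ) = s from h0, evolution_zero hP] at this
      have := mul_pos hε (hg0 j)
      simp at *
      linarith
    have hder : HasDerivAt (fun r => z (r, j))
        (Real.exp (-c * s) * generator p q (evolution P h s) j -
          c * (Real.exp (-c * s) * evolution P h s j)) s := by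
      have h1 : HasDerivAt (fun r : ℝ => Real.exp (-c * r)) (Real.exp (-c * s) * (-c)) s := by
        simpa using ((hasDerivAt_id s).const_mul (-c)).exp
      refine (((h1.mul (hasDerivAt_evolution hP hB j hspos)).sub_const (h j)).sub_const
        (ε * g j)).congr_deriv ?_
      ring
    have hd0 := nonneg_of_hasDerivAt_of_left_max hspos hder fun r hr =>
      hmax' r ⟨hr.1, hr.2.trans hs.2⟩ j hj
    have hgen : generator p q (fun k => z (s, k)) j ≤ 0 :=
      generator_nonpos_of_max hp hq fun k => by
        rcases lt_or_ge k n with hk | hk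
        · exact hmax' s hs k hk
        · exact (hfar s k hs.1 hk).trans hzpos.le
    have hlin : generator p q (fun k => z (s, k)) j =
        Real.exp (-c * s) * generator p q (evolution P h s) j - generator p q h j
          - ε * generator p q g j := by
      simp only [generator, hzdef]; ring
    -- At the maximum, `0 ≤ ∂ₛ z = L z + L h + ε L g - c exp (-c s) P_s h ≤ -c z < 0`, a
    -- contradiction.
    have h1 := hhc j
    have h2 := mul_le_mul_of_nonneg_left (hgc j) hε.le
    have h3 := mul_pos hc hzpos
    simp only [hzdef] at h3
    nlinarith
  refine le_of_forall_pos_le_add fun δ hδ => ?_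
  have := main (δ / g i) (div_pos hδ (hg0 i))
  rwa [div_mul_cancel₀ _ (hg0 i).ne'] at this

/-- The rate bounds give `L g ≤ c g` for `g i = i + 1` and `L h ≤ c h` for `h i = 1 / (i + 1)`;
indeed `L h i = (q i / i - p i / (i + 2)) * h i` for `i ≥ 1`. -/
theorem not_isStronglyErgodic_of_rates (hP : IsQProcess (birthDeath p q) P)
    (hp : ∀ i, 0 ≤ p i) (hq : ∀ i, 1 ≤ i → 0 ≤ q i) {c : ℝ} (hc : 0 < c) (hp0 : p 0 ≤ c)
    (hpq : ∀ i, 1 ≤ i → p i ≤ q i + c)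
    (hqp : ∀ i : ℕ, 1 ≤ i → q i / i - p i / (i + 2) ≤ c) : ¬ IsStronglyErgodic P := by
  have := hP.markov
  rintro ⟨ε, hε, C, hC, π, hπ, hconv⟩
  have := hπ.1
  obtain ⟨T, hT⟩ : ∃ T : ℝ≥0, C * Real.exp (-ε * T) ≤ 1 / 4 := by
    have h1 : Tendsto (fun t : ℝ => C * Real.exp (-ε * t)) atTop (𝓝 (C * 0)) := by
      refine (Real.tendsto_exp_atBot.comp ?_).const_mul C
      exact tendsto_id.const_mul_atTop_of_neg (by linarith)
    rw [mul_zero] at h1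
    obtain ⟨T, h2, h3⟩ := ((h1.eventually_le_const (by norm_num : (0 : ℝ) < 1 / 4)).and
      (eventually_ge_atTop 0)).exists
    exact ⟨⟨T, h3⟩, h2⟩
  obtain ⟨m, hm⟩ : ∃ m : ℕ, 3 / 4 ≤ π.real (Set.Iic m) := by
    have h1 := tendsto_measure_Iic_atTop π
    rw [measure_univ] at h1
    have h2 := (ENNReal.tendsto_toReal ENNReal.one_ne_top).comp h1
    exact (h2.eventually_const_le (by norm_num : (3 / 4 : ℝ) < ENNReal.toReal 1)).exists
  -- `3/4` of the mass of `π`, less a total variation error of at most `1/4`, uniformly in `i`.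
  have hhalf : ∀ i, 1 / 2 ≤ (P T i).real (Set.Iic m) := by
    intro i
    have h1 := (abs_sub_le_tvDist (μ := P T i) (ν := π) (Set.Iic m)).trans
      ((hconv T i).trans hT)
    linarith [(abs_le.1 h1).1]
  set h : ℕ → ℝ := fun i => 1 / ((i : ℝ) + 1) with hh
  have hpos : ∀ i, 0 < h i := fun i => by simp only [hh]; positivity
  have hB : ∀ i, |h i| ≤ 1 := fun i => by
    rw [abs_of_pos (hpos i)]
    exact (div_le_one (by positivity)).2 (by simp)
  have hhc : ∀ i, generator p q h i ≤ c * h i := by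
    intro i
    rcases i with _ | i
    · have := hp 0
      simp [generator, hh]
      norm_num
      linarith
    · have h1 := hqp (i + 1) (by omega)
      have h2 : generator p q h (i + 1) =
          (q (i + 1) / ((i + 1 : ℕ) : ℝ) - p (i + 1) / ((i + 1 : ℕ) + 2)) * h (i + 1) := by
        simp only [generator, hh, add_tsub_cancel_right]
        push_cast
        field_simp
        ring
      rw [h2]
      exact mul_le_mul_of_nonneg_right h1 (hpos _).le
  have hgc : ∀ i, generator p q (fun i => (i : ℝ) + 1) i ≤ c * ((i : ℝ) + 1) := by
    intro i
    rcases i with _ | i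
    · simpa [generator] using hp0
    · have h1 := hpq (i + 1) (by omega)
      simp only [generator, add_tsub_cancel_right]
      push_cast
      have : 0 ≤ (i : ℝ) := i.cast_nonneg
      nlinarith
  have hcomp := fun i => evolution_le_of_generator_le hP hp hq hc
    (g := fun i : ℕ => (i : ℝ) + 1) (fun i => by positivity)
    (tendsto_atTop_add_const_right _ 1 tendsto_natCast_atTop_atTop) hgc hB hhc T.coe_nonneg i
  have hlow : ∀ i, h m / 2 ≤ evolution P h T i := by
    intro i
    have h1 : ∫ y, (Set.Iic m).indicator (fun _ => h m) y ∂(P T i) ≤ ∫ y, h y ∂(P T i) := by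
      refine integral_mono_of_nonneg (ae_of_all _ fun y => Set.indicator_nonneg
        (fun _ _ => (hpos m).le) y) (integrable_of_abs_le hB) (ae_of_all _ fun y => ?_)
      refine Set.indicator_le' (fun y hy => ?_) (fun y _ => (hpos y).le) y
      exact one_div_le_one_div_of_le (by positivity)
        (by have : (y : ℝ) ≤ m := by exact_mod_cast hy
            linarith)
    rw [integral_indicator_const _ .of_discrete, smul_eq_mul] at h1
    simp only [evolution, Real.toNNReal_coe]
    have := mul_le_mul_of_nonneg_right (hhalf i) (hpos m).le
    linarith
  have hlim : Tendsto h atTop (𝓝 0) := tendsto_one_div_add_atTop_nhds_zero_nat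
  have hcontra : Real.exp (-c * T) * (h m / 2) ≤ 0 := ge_of_tendsto' hlim fun i =>
    (mul_le_mul_of_nonneg_left (hlow i) (Real.exp_pos _).le).trans (hcomp i)
  have := mul_pos (Real.exp_pos (-c * T)) (half_pos (hpos m))
  linarith

end BirthDeath

/-! ### Positivity of transition probabilities and an inequality for invariant laws. -/

section Discrete

variable {E : Type*} [Countable E] [MeasurableSpace E] [DiscreteMeasurableSpace E]
  {Q : Matrix E E ℝ} {P : ℝ≥0 → Kernel E E}

theorem real_eq_integral_indicator {μ : Measure E} (A : Set E) :
    μ.real A = ∫ y, A.indicator 1 y ∂μ :=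
  (integral_indicator_one (MeasurableSet.of_discrete (s := A))).symm

theorem mul_real_le_real_add_time (hP : IsTransitionFunction P) (s t : ℝ≥0) (i k j : E) :
    (P s i).real {k} * (P t k).real {j} ≤ (P (s + t) i).real {j} := by
  have := hP.markov
  rw [real_eq_integral_indicator (μ := P (s + t) i), integral_add_time hP s t (B := 1)
    (fun x => by by_cases hx : x ∈ ({j} : Set E) <;> simp [hx])]
  simp_rw [← real_eq_integral_indicator]
  have h1 : (P s i).real {k} * (P t k).real {j} =
      ∫ y, ({k} : Set E).indicator (fun _ => (P t k).real {j}) y ∂(P s i) := by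
    rw [integral_indicator_const _ .of_discrete, smul_eq_mul]
  rw [h1]
  refine integral_mono_of_nonneg (ae_of_all _ fun y => Set.indicator_nonneg
    (fun _ _ => measureReal_nonneg) y) (integrable_of_abs_le (B := 1) fun y => ?_)
    (ae_of_all _ fun y => Set.indicator_le' (fun y hy => ?_) (fun y _ => measureReal_nonneg) y)
  · rw [abs_of_nonneg measureReal_nonneg]; exact measureReal_le_one
  · rw [Set.mem_singleton_iff.1 hy]

/-- Cut `[0, t]` into pieces so short that being back at `i` after each has positive probability. -/
theorem IsQProcess.real_self_pos (hP : IsQProcess Q P) (i : E) (t : ℝ≥0) :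
    0 < (P t i).real {i} := by
  have h1 := (hP.tendsto_real_self i).eventually_const_lt one_pos
  have h2 : Tendsto (fun n : ℕ => t / (n + 1)) atTop (𝓝 0) := by
    have := (tendsto_one_div_add_atTop_nhds_zero_nat (𝕜 := ℝ≥0)).const_mul t
    simpa [div_eq_mul_inv] using this
  obtain ⟨n, hn⟩ := (h2.eventually h1).exists
  have h3 : ∀ k : ℕ, 0 < (P (k * (t / (n + 1))) i).real {i} := by
    intro k
    induction k with
    | zero => simp [hP.real_zero_self]
    | succ k ih =>
      have := mul_real_le_real_add_time hP.toIsTransitionFunction (k * (t / (n + 1)))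
        (t / (n + 1)) i i i
      rw [Nat.cast_succ, add_one_mul]
      exact (mul_pos ih hn).trans_le this
  have h4 := h3 (n + 1)
  rwa [Nat.cast_succ, mul_div_cancel₀ _ (by positivity)] at h4

theorem IsQProcess.real_pos_of_rate_pos (hP : IsQProcess Q P) {i j : E} (hij : i ≠ j)
    (hQ : 0 < Q i j) {t : ℝ≥0} (ht : 0 < t) : 0 < (P t i).real {j} := by
  have h0 : (P 0 i).real {j} = 0 := by
    rw [hP.zero, Kernel.id_apply]; simp [Measure.real, hij]
  obtain ⟨s, ⟨hs, hst⟩⟩ := (((hP.deriv_zero i j).eventually_const_lt hQ).and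
    (Ioo_mem_nhdsGT ht)).exists
  rw [h0, sub_zero] at hs
  have h1 : 0 < (P s i).real {j} := by
    by_contra! h
    exact absurd hs (not_lt.2 (div_nonpos_of_nonpos_of_nonneg h s.coe_nonneg))
  have h2 := mul_real_le_real_add_time hP.toIsTransitionFunction s (t - s) i j j
  rw [add_tsub_cancel_of_le hst.2.le] at h2
  exact (mul_pos h1 (hP.real_self_pos j _)).trans_le h2

/-- Invariance gives `∑ i ∈ N, π i * P_t(i, j) ≤ π j`, with equality at `t = 0`. Keeping only
finitely many states avoids exchanging a limit with an infinite sum. -/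
theorem IsInvariantProb.sum_mul_rate_nonpos (hP : IsQProcess Q P) {π : Measure E}
    (hπ : IsInvariantProb P π) {N : Finset E} {j : E} (hj : j ∈ N) :
    ∑ i ∈ N, π.real {i} * Q i j ≤ 0 := by
  have := hP.markov
  have := hπ.1
  classical
  have h0 : ∀ i, (P 0 i).real {j} = if i = j then 1 else 0 := fun i => by
    rw [hP.zero, Kernel.id_apply]
    by_cases h : i = j <;> simp [Measure.real, h]
  have hlim : Tendsto (fun t : ℝ≥0 => ∑ i ∈ N,
      π.real {i} * (((P t i).real {j} - (P 0 i).real {j}) / (t : ℝ))) (𝓝[>] 0)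
      (𝓝 (∑ i ∈ N, π.real {i} * Q i j)) :=
    tendsto_finsetSum _ fun i _ => (hP.deriv_zero i j).const_mul _
  refine le_of_tendsto' hlim fun t => ?_
  have hi : Integrable (fun y => (P t y).real {j}) π := integrable_of_abs_le (B := 1) fun y => by
    rw [abs_of_nonneg measureReal_nonneg]; exact measureReal_le_one
  have h1 : ∑ i ∈ N, π.real {i} * (P t i).real {j} ≤ π.real {j} := by
    rw [real_eq_integral_of_invariant (hπ.2 t) {j}]
    refine le_trans (le_of_eq ?_) (setIntegral_le_integral (s := (N : Set E)) hi
      (ae_of_all _ fun y => measureReal_nonneg))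
    simpa using (setIntegral_finset N hi.integrableOn).symm
  have h2 : ∑ i ∈ N, π.real {i} * (((P t i).real {j} - (P 0 i).real {j}) / (t : ℝ)) =
      ((∑ i ∈ N, π.real {i} * (P t i).real {j}) - π.real {j}) / t := by
    have h3 : π.real {j} = ∑ i ∈ N, π.real {i} * (P 0 i).real {j} := by simp [h0, hj]
    conv_rhs => rw [h3]
    rw [← Finset.sum_sub_distrib, Finset.sum_div]
    exact Finset.sum_congr rfl fun i _ => by ring
  rw [h2]
  exact div_nonpos_of_nonpos_of_nonneg (by linarith) t.coe_nonneg

end Discrete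

/-! ### The reversible measure: invariance, and necessity of summability. -/

section BirthDeath

variable {p q : ℕ → ℝ} {P : ℝ≥0 → Kernel ℕ ℕ}

theorem real_pos_of_birthDeath (hP : IsQProcess (birthDeath p q) P) (hp : ∀ i, 0 < p i)
    (hq : ∀ i, 1 ≤ i → 0 < q i) {t : ℝ≥0} (ht : 0 < t) (i j : ℕ) : 0 < (P t i).real {j} := by
  have hup : ∀ (n i : ℕ) {t : ℝ≥0}, 0 < t → 0 < (P t i).real {i + n} := by
    intro n i
    induction n with
    | zero => exact fun {t} _ => hP.real_self_pos i t
    | succ n ih =>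
      intro t ht
      have h1 := hP.real_pos_of_rate_pos (i := i + n) (j := i + n + 1) (by omega)
        (by simpa [birthDeath] using hp (i + n)) (half_pos ht)
      have h2 := mul_real_le_real_add_time hP.toIsTransitionFunction (t / 2) (t / 2) i (i + n)
        (i + n + 1)
      rw [add_halves] at h2
      exact (mul_pos (ih (half_pos ht)) h1).trans_le h2
  have hdown : ∀ (n i : ℕ) {t : ℝ≥0}, 0 < t → 0 < (P t (i + n)).real {i} := by
    intro n i
    induction n with
    | zero => exact fun {t} _ => hP.real_self_pos i t
    | succ n ih =>
      intro t ht
      have h1 := hP.real_pos_of_rate_pos (i := i + n + 1) (j := i + n) (by omega)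
        (by simpa [birthDeath, show i + n ≠ i + n + 1 + 1 by omega]
          using hq (i + n + 1) (by omega)) (half_pos ht)
      have h2 := mul_real_le_real_add_time hP.toIsTransitionFunction (t / 2) (t / 2) (i + n + 1)
        (i + n) i
      rw [add_halves] at h2
      exact (mul_pos h1 (ih (half_pos ht))).trans_le h2
  rcases le_total i j with h | h
  · obtain ⟨n, rfl⟩ := Nat.exists_eq_add_of_le h
    exact hup n i ht
  · obtain ⟨n, rfl⟩ := Nat.exists_eq_add_of_le h
    exact hdown n j ht

theorem sum_mul_generator {μ : ℕ → ℝ} (hbal : ∀ i, μ i * p i = μ (i + 1) * q (i + 1))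
    (f : ℕ → ℝ) (N : ℕ) :
    ∑ i ∈ Finset.range (N + 1), μ i * generator p q f i = μ N * p N * (f (N + 1) - f N) := by
  induction N with
  | zero => simp [generator]; ring
  | succ N ih =>
    rw [Finset.sum_range_succ, ih]
    simp only [generator, add_tsub_cancel_right]
    linear_combination (f (N + 1) - f N) * hbal N

theorem not_bounded_of_eventually_increment {g : ℕ → ℝ} {C δ : ℝ} (hδ : 0 < δ)
    (hg : ∀ n, |g n| ≤ C) (hinc : ∀ᶠ n in atTop, δ ≤ g (n + 1) - g n) : False := by
  obtain ⟨N, hN⟩ := eventually_atTop.1 hinc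
  have h1 : ∀ k : ℕ, g N + k * δ ≤ g (N + k) := by
    intro k
    induction k with
    | zero => simp
    | succ k ih =>
      have := hN (N + k) (by omega)
      push_cast
      rw [← add_assoc]
      linarith
  obtain ⟨k, hk⟩ := exists_nat_gt (2 * C / δ)
  rw [div_lt_iff₀ hδ] at hk
  have := h1 k
  linarith [(abs_le.1 (hg N)).1, (abs_le.1 (hg (N + k))).2]

/-- Partial sums of the difference equal `μ N * p N * (g (N + 1) - g N)`, where `g n` is the time
integral of `P_s f n` and is bounded by `B * t`. A limit `L > 0` would give increments of `g` at
least `L / (2 * A)` eventually. Applying this to `-f` yields the other inequality. -/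
theorem tsum_mul_integral_eq (hP : IsQProcess (birthDeath p q) P) {μ : ℕ → ℝ}
    (hμ : ∀ i, 0 < μ i) (hsum : Summable μ) (hp : ∀ i, 0 < p i)
    (hbal : ∀ i, μ i * p i = μ (i + 1) * q (i + 1)) {A : ℝ} (hA : ∀ i, μ i * p i ≤ A)
    {f : ℕ → ℝ} {B : ℝ} (hf : ∀ i, |f i| ≤ B) (t : ℝ≥0) :
    ∑' i, μ i * ∫ y, f y ∂(P t i) = ∑' i, μ i * f i := by
  have hsummable : ∀ {g : ℕ → ℝ} {C : ℝ}, (∀ i, |g i| ≤ C) → Summable fun i => μ i * g i := by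
    intro g C hC
    refine Summable.of_norm_bounded (hsum.mul_right C) fun i => ?_
    rw [Real.norm_eq_abs, abs_mul, abs_of_pos (hμ i)]
    exact mul_le_mul_of_nonneg_left (hC i) (hμ i).le
  have hle : ∀ {f : ℕ → ℝ} {B : ℝ}, (∀ i, |f i| ≤ B) →
      ∑' i, μ i * ∫ y, f y ∂(P t i) ≤ ∑' i, μ i * f i := by
    intro f B hf
    by_contra! hcon
    have hu : ∀ i, |∫ y, f y ∂(P t i)| ≤ B := fun i => by
      simpa [evolution] using abs_evolution_le hP hf t i
    set L := (∑' i, μ i * ∫ y, f y ∂(P t i)) - ∑' i, μ i * f i with hL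
    have hLpos : 0 < L := sub_pos.2 hcon
    have hB : 0 ≤ B := (abs_nonneg _).trans (hf 0)
    have hApos : 0 < A := (mul_pos (hμ 0) (hp 0)).trans_le (hA 0)
    set g : ℕ → ℝ := fun n => ∫ s in (0 : ℝ)..t, evolution P f s n with hg
    have hint : ∀ n, IntervalIntegrable (fun s => evolution P f s n) volume 0 t := fun n =>
      (continuous_evolution hP hf n).intervalIntegrable _ _
    have hpartial : ∀ N, ∑ i ∈ Finset.range (N + 1), (μ i * (∫ y, f y ∂(P t i)) - μ i * f i) =
        μ N * p N * (g (N + 1) - g N) := by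
      intro N
      have h1 : ∀ i, μ i * (∫ y, f y ∂(P t i)) - μ i * f i =
          ∫ s in (0 : ℝ)..t, μ i * generator p q (evolution P f s) i := by
        intro i
        rw [intervalIntegral.integral_const_mul, integral_generator_evolution hP hf i t.coe_nonneg]
        simp only [evolution, Real.toNNReal_coe]
        ring
      simp_rw [h1]
      rw [← intervalIntegral.integral_finsetSum fun i _ =>
        ((continuous_generator_evolution hP hf i).const_mul (μ i)).intervalIntegrable _ _]
      simp_rw [sum_mul_generator hbal]
      rw [intervalIntegral.integral_const_mul, intervalIntegral.integral_sub (hint _) (hint _)]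
    have hlim : Tendsto (fun N => μ N * p N * (g (N + 1) - g N)) atTop (𝓝 L) := by
      simp_rw [← hpartial]
      have := ((hsummable hu).hasSum.sub (hsummable hf).hasSum).tendsto_sum_nat
      exact this.comp (tendsto_add_atTop_nat 1)
    refine not_bounded_of_eventually_increment (g := g) (C := B * t) (δ := L / 2 / A)
      (by positivity) (fun n => ?_) ?_
    · have := intervalIntegral.norm_integral_le_of_norm_le_const (a := 0) (b := (t : ℝ)) (C := B)
        (f := fun s => evolution P f s n) fun s _ => abs_evolution_le hP hf s n
      simpa using this
    · filter_upwards [hlim.eventually_const_le (half_lt_self hLpos)] with N hN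
      have h2 : 0 < μ N * p N := mul_pos (hμ N) (hp N)
      have h3 : 0 < g (N + 1) - g N := by
        by_contra! h
        nlinarith
      rw [div_le_iff₀ hApos]
      nlinarith [hA N]
  refine le_antisymm (hle hf) ?_
  have := hle (f := fun i => -f i) (B := B) (fun i => by rw [abs_neg]; exact hf i)
  simp only [integral_neg, mul_neg, tsum_neg] at this
  linarith

theorem exists_isInvariantProb (hP : IsQProcess (birthDeath p q) P) {μ : ℕ → ℝ}
    (hμ : ∀ i, 0 < μ i) (hsum : Summable μ) (hp : ∀ i, 0 < p i)
    (hbal : ∀ i, μ i * p i = μ (i + 1) * q (i + 1)) {A : ℝ} (hA : ∀ i, μ i * p i ≤ A) :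
    ∃ ρ : Measure ℕ, IsInvariantProb P ρ ∧ ∀ i, 0 < ρ.real {i} := by
  have := hP.markov
  set Z := ∑' i, μ i with hZ
  have hZpos : 0 < Z := hsum.tsum_pos (fun i => (hμ i).le) 0 (hμ 0)
  have hν : ∀ i, 0 < μ i / Z := fun i => div_pos (hμ i) hZpos
  have hνsum : HasSum (fun i => μ i / Z) 1 := by
    have := hsum.hasSum.div_const Z
    rwa [← hZ, div_self hZpos.ne'] at this
  let w : PMF ℕ := ⟨fun i => ENNReal.ofReal (μ i / Z), by
    have := ENNReal.hasSum_coe.2 (hνsum.toNNReal fun i => (hν i).le)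
    rwa [Real.toNNReal_one] at this⟩
  set ρ : Measure ℕ := w.toMeasure with hρ
  have hreal : ∀ i, ρ.real {i} = μ i / Z := fun i => by
    rw [Measure.real, hρ, PMF.toMeasure_apply_singleton _ _ .of_discrete]
    exact ENNReal.toReal_ofReal (hν i).le
  have hprob : IsProbabilityMeasure ρ := PMF.toMeasure.isProbabilityMeasure w
  refine ⟨ρ, ⟨hprob, fun t => ?_⟩, fun i => by rw [hreal]; exact hν i⟩
  refine Measure.ext_of_measureReal_singleton fun j => ?_
  have hf : ∀ i, |({j} : Set ℕ).indicator (1 : ℕ → ℝ) i| ≤ 1 := fun i => by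
    by_cases hi : i ∈ ({j} : Set ℕ) <;> simp [hi]
  rw [real_eq_integral_indicator, real_eq_integral_indicator (μ := ρ), integral_bind_of_abs_le hf,
    integral_countable (integrable_of_abs_le fun i => abs_integral_le_of_abs_le hf),
    integral_countable (integrable_of_abs_le hf)]
  simp_rw [hreal, smul_eq_mul]
  refine tsum_mul_integral_eq hP hν hνsum.summable hp (fun i => ?_) (A := A / Z) (fun i => ?_) hf t
  · rw [div_mul_eq_mul_div, div_mul_eq_mul_div, hbal]
  · rw [div_mul_eq_mul_div]
    exact div_le_div_of_nonneg_right (hA i) hZpos.le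

theorem isErgodic_of_summable (hP : IsQProcess (birthDeath p q) P) {μ : ℕ → ℝ}
    (hμ : ∀ i, 0 < μ i) (hsum : Summable μ) (hp : ∀ i, 0 < p i) (hq : ∀ i, 1 ≤ i → 0 < q i)
    (hbal : ∀ i, μ i * p i = μ (i + 1) * q (i + 1)) {A : ℝ} (hA : ∀ i, μ i * p i ≤ A) :
    IsErgodic P := by
  obtain ⟨ρ, hρ, hpos⟩ := exists_isInvariantProb hP hμ hsum hp hbal hA
  exact isErgodic_of_pos hP.toIsTransitionFunction hρ hpos
    (real_pos_of_birthDeath hP hp hq one_pos)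

/-- Increments are nonincreasing and start at or below zero; a negative one would drive `m` to `-∞`.
-/
theorem eq_of_concave_nonneg {m : ℕ → ℝ} (hm : ∀ i, 0 ≤ m i) (h0 : m 1 ≤ m 0)
    (hconc : ∀ i, m i + m (i + 2) ≤ 2 * m (i + 1)) (i : ℕ) : m i = m 0 := by
  have hD : Antitone fun k => m (k + 1) - m k := antitone_nat_of_succ_le fun k => by
    have := hconc k
    rw [show k + 1 + 1 = k + 2 from rfl]
    linarith
  have hD0 : ∀ k, m (k + 1) - m k ≤ 0 := fun k => (hD (Nat.zero_le k)).trans (by simpa using h0)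
  have hD1 : ∀ k, m (k + 1) - m k = 0 := by
    intro k
    refine le_antisymm (hD0 k) ?_
    by_contra! hneg
    have hbd : ∀ n, |-m n| ≤ m 0 := fun n => by
      rw [abs_neg, abs_of_nonneg (hm n)]
      exact antitone_nat_of_succ_le (fun k => by linarith [hD0 k]) (Nat.zero_le n)
    refine not_bounded_of_eventually_increment (neg_pos.2 hneg) hbd ?_
    filter_upwards [eventually_ge_atTop k] with n hn
    have := hD hn
    simp only at this
    linarith
  induction i with
  | zero => rfl
  | succ i ih => linarith [hD1 i]

/-- Column `0` of `π Q ≤ 0` gives `m 1 ≤ m 0` for `m i = π i * p i`, and the other columns give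
concavity. So `m` is a constant, nonzero because `π` has mass one, and `1 / p i` is proportional to
`π i`. -/
theorem summable_inv_of_isInvariantProb (hP : IsQProcess (birthDeath p q) P) (hp : ∀ i, 0 < p i)
    (hpq : ∀ i, 1 ≤ i → q i = p i) {π : Measure ℕ} (hπ : IsInvariantProb P π) :
    Summable fun i => 1 / p i := by
  have := hπ.1
  have hconst := eq_of_concave_nonneg (m := fun i => π.real {i} * p i)
    (fun i => mul_nonneg measureReal_nonneg (hp i).le) (by
      have := hπ.sum_mul_rate_nonpos hP (N := {0, 1}) (j := 0) (by simp)
      simp [birthDeath, hpq] at this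
      linarith) (fun i => by
      have h1 : i ∉ ({i + 1, i + 2} : Finset ℕ) := by simp
      have h2 : i + 1 ∉ ({i + 2} : Finset ℕ) := by simp
      have := hπ.sum_mul_rate_nonpos hP (N := {i, i + 1, i + 2}) (j := i + 1) (by simp)
      rw [Finset.sum_insert h1, Finset.sum_insert h2] at this
      simp [birthDeath, hpq] at this
      linarith)
  have hs : HasSum (fun i => π.real {i}) 1 := by
    have h1 := integral_countable (integrable_const (μ := π) (1 : ℝ))
    simp only [integral_const, probReal_univ, smul_eq_mul, mul_one] at h1
    have h2 : Summable fun i => π.real {i} := by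
      by_contra h
      rw [tsum_eq_zero_of_not_summable h] at h1
      exact one_ne_zero h1
    exact h1 ▸ h2.hasSum
  have hc : π.real {0} * p 0 ≠ 0 := by
    intro hc
    have : (fun i => π.real {i}) = fun _ => 0 := by
      funext i
      have := hconst i
      rw [hc] at this
      exact (mul_eq_zero.1 this).resolve_right (hp i).ne'
    rw [this] at hs
    exact zero_ne_one (hasSum_zero.unique hs)
  have := hs.summable.mul_left (π.real {0} * p 0)⁻¹
  refine this.congr fun i => ?_
  rw [← hconst i, mul_inv, mul_right_comm, inv_mul_cancel₀, one_mul, one_div]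
  intro h
  rw [← hconst i, h, zero_mul] at hc
  exact hc rfl

end BirthDeath

end MarkovErgodicity

/-! ### The three families of rates. -/

theorem corollary3 :
    (∀ (α : ℝ) (p q : ℕ → ℝ), 0 < p 0 →
      (∀ i : ℕ, 1 ≤ i → p i = (i : ℝ) ^ α ∧ q i = (i : ℝ) ^ α) →
      ∀ P : ℝ≥0 → Kernel ℕ ℕ, MarkovErgodicity.IsQProcess (MarkovErgodicity.birthDeath p q) P →
        (MarkovErgodicity.IsErgodic P ↔ 1 < α) ∧
        (1 < α → α ≤ 2 → ¬ MarkovErgodicity.IsStronglyErgodic P)) ∧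
    (∀ p q : ℝ, 0 < p → p < q →
      ∀ P : ℝ≥0 → Kernel ℕ ℕ,
        MarkovErgodicity.IsQProcess
          (MarkovErgodicity.birthDeath (fun _ => p) (fun _ => q)) P →
        MarkovErgodicity.IsErgodic P ∧ ¬ MarkovErgodicity.IsStronglyErgodic P) ∧
    (∀ p α : ℝ, 0 < p → 0 < α → α ≤ 1 →
      ∀ P : ℝ≥0 → Kernel ℕ ℕ,
        MarkovErgodicity.IsQProcess
          (MarkovErgodicity.birthDeath (fun _ => p) (fun i => (i : ℝ) ^ α)) P →
        ¬ MarkovErgodicity.IsStronglyErgodic P) := by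
  refine ⟨fun α p q hp0 hpq P hP => ?_, fun p q hp hpq P hP => ⟨?_, ?_⟩,
    fun p α hp hα hα1 P hP => ?_⟩
  · have hcast : ∀ i : ℕ, 1 ≤ i → (1 : ℝ) ≤ i := fun i hi => by exact_mod_cast hi
    have hp : ∀ i, 0 < p i := fun i => by
      rcases Nat.eq_zero_or_pos i with rfl | hi
      · exact hp0
      · rw [(hpq i hi).1]
        exact Real.rpow_pos_of_pos (by linarith [hcast i hi]) α
    have hqp : ∀ i, 1 ≤ i → q i = p i := fun i hi => (hpq i hi).2.trans (hpq i hi).1.symm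
    have hq : ∀ i, 1 ≤ i → 0 < q i := fun i hi => (hqp i hi) ▸ hp i
    -- Shifting by one discards index `0`, where `p 0` is arbitrary.
    have hsum : Summable (fun i => 1 / p i) ↔ 1 < α := by
      rw [← Real.summable_one_div_nat_rpow, ← summable_nat_add_iff 1,
        ← summable_nat_add_iff (f := fun n : ℕ => 1 / (n : ℝ) ^ α) 1]
      exact summable_congr fun i => by rw [(hpq (i + 1) (by omega)).1]
    refine ⟨⟨fun ⟨π, hπ, _⟩ => hsum.1 ?_, fun hα => ?_⟩, fun _ hα2 => ?_⟩
    · exact MarkovErgodicity.summable_inv_of_isInvariantProb hP hp hqp hπ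
    · refine MarkovErgodicity.isErgodic_of_summable hP (fun i => one_div_pos.2 (hp i)) (hsum.2 hα)
        hp hq (fun i => ?_) (A := 1) fun i => ?_
      · rw [hqp (i + 1) (by omega), one_div_mul_cancel (hp i).ne',
          one_div_mul_cancel (hp (i + 1)).ne']
      · rw [one_div_mul_cancel (hp i).ne']
    -- The `2` in `c` comes from `p i / i - p i / (i + 2) = 2 * p i / (i * (i + 2))` and `p i ≤ i ^
    -- 2`; the `p 0` covers state `0`.
    · refine MarkovErgodicity.not_isStronglyErgodic_of_rates hP (fun i => (hp i).le)
        (fun i hi => (hq i hi).le) (c := p 0 + 2) (by linarith) (by linarith)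
        (fun i hi => by rw [hqp i hi]; linarith) fun i hi => ?_
      have h1 := hcast i hi
      rw [hqp i hi]
      have h2 : p i ≤ (i : ℝ) ^ 2 := by
        rw [(hpq i hi).1, ← Real.rpow_two]
        exact Real.rpow_le_rpow_of_exponent_le h1 hα2
      have h3 : p i / i - p i / (i + 2) ≤ 2 := by
        rw [div_sub_div _ _ (by positivity) (by positivity), div_le_iff₀ (by positivity)]
        nlinarith
      linarith
  · have hq : 0 < q := hp.trans hpq
    have hr : 0 < p / q := div_pos hp hq
    refine MarkovErgodicity.isErgodic_of_summable hP (μ := fun i => (p / q) ^ i)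
      (fun i => pow_pos hr i) (summable_geometric_of_lt_one hr.le ((div_lt_one hq).2 hpq))
      (fun _ => hp) (fun _ _ => hq) (fun i => ?_) (A := p) fun i => ?_
    · rw [pow_succ, mul_assoc, div_mul_cancel₀ _ hq.ne']
    · exact mul_le_of_le_one_left hp.le (pow_le_one₀ hr.le ((div_lt_one hq).2 hpq).le)
  · have hq : 0 < q := hp.trans hpq
    refine MarkovErgodicity.not_isStronglyErgodic_of_rates hP (fun _ => hp.le) (fun _ _ => hq.le)
      hq hpq.le (fun i _ => by linarith) fun i hi => ?_
    have h1 : (1 : ℝ) ≤ i := by exact_mod_cast hi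
    have h2 : q / i ≤ q := div_le_self hq.le h1
    have h3 : 0 ≤ p / ((i : ℝ) + 2) := by positivity
    linarith
  -- In `c = p + 1`, the `1` bounds `i ^ α / i`, which is where `α ≤ 1` enters.
  · refine MarkovErgodicity.not_isStronglyErgodic_of_rates hP (fun _ => hp.le)
      (fun i _ => by positivity) (c := p + 1) (by linarith) (by linarith) (fun i _ => ?_)
      fun i hi => ?_
    · have : 0 ≤ (i : ℝ) ^ α := by positivity
      linarith
    · have h1 : (1 : ℝ) ≤ i := by exact_mod_cast hi
      have h2 : (i : ℝ) ^ α / i ≤ 1 := by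
        rw [div_le_one (by linarith)]
        exact Real.rpow_le_self_of_one_le h1 hα1
      have h3 : 0 ≤ p / ((i : ℝ) + 2) := by positivity
      linarith
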